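/- All graphs are finite, simple, undirected and have at least one vertex; they need not be connected. A graph is \emph{distance-hereditary} if, up to isomorphism, it can be constructed from a single isolated vertex by repeatedly applying the following operations to the current graph $G$ and a vertex $u \in V(G)$: add a \emph{pendant} vertex (a new vertex $v$ whose only neighbour is $u$); add a \emph{true twin} of $u$ (a new vertex $v$ with neighbourhood $N(u) \cup \{u\}$); add a \emph{false twin} of $u$ (a new vertex $v$ with neighbourhood $N(u)$). It is \emph{strongly distance-hereditary} if it can be constructed in this way with true twins added only on vertices $u$ with $|N(u)| = 1$ and false twins added only on vertices $u$ for which no two vertices of $N(u)$ are adjacent (in the current graph). A graph is \emph{sc-orientable} if its edges can be directed such that in the resulting digraph there is, for every ordered pair of vertices $(s,t)$, at most one directed path (without repeated vertices) from $s$ to $t$. The \emph{diamond} is the $4$-cycle with one chord, the \emph{house} is the $4$-cycle with one more vertex adjacent to exactly two consecutive vertices of the cycle, the \emph{domino} is the $2 \times 3$ grid, and a \emph{hole} is an induced cycle of length at least $5$. Lemma. For every graph $G$ the following are equivalent: (1) $G$ is strongly distance-hereditary; (2) $G$ contains no hole, no house and no domino as an induced subgraph, and no diamond as a (not necessarily induced)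 subgraph; (3) $G$ is distance-hereditary and sc-orientable. -/

import Mathlib

universe u

namespace SCOrient

/-! ### Distance-hereditary graphs -/

/-- The graph obtained from `G` by adding one new vertex `none` whose neighbourhood is `N`. -/
def addVertex {V : Type u} (G : SimpleGraph V) (N : Set V) : SimpleGraph (Option V) where
  Adj
    | some x, some y => G.Adj x y
    | some x, none => x ∈ N
    | none, some y => y ∈ N
    | none, none => False
  symm := ⟨by
    rintro (_ | x) (_ | y) h
    · exact h
    · exact h
    · exact h
    · exact G.symm.symm _ _ h⟩
  loopless := ⟨by
    rintro (_ | x) h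
    · exact h
    · exact G.loopless.irrefl x h⟩

/-- Add a pendant vertex to `u`. -/
def addPendant {V : Type u} (G : SimpleGraph V) (u : V) : SimpleGraph (Option V) :=
  addVertex G {u}

/-- Add a true twin of `u`: the new vertex is adjacent to `u` and to all neighbours of `u`. -/
def addTrueTwin {V : Type u} (G : SimpleGraph V) (u : V) : SimpleGraph (Option V) :=
  addVertex G (insert u (G.neighborSet u))

/-- Add a false twin of `u`: the new vertex is adjacent exactly to the neighbours of `u`. -/
def addFalseTwin {V : Type u} (G : SimpleGraph V) (u : V) : SimpleGraph (Option V) :=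
  addVertex G (G.neighborSet u)

/-- Distance-hereditary graphs: up to isomorphism, the graphs that can be constructed from a
single isolated vertex by adding pendant vertices, true twins and false twins. -/
inductive IsDistanceHereditary : ∀ {V : Type u}, SimpleGraph V → Prop
  | single : IsDistanceHereditary (⊥ : SimpleGraph PUnit.{u + 1})
  | pendant {V : Type u} {G : SimpleGraph V} (u : V) :
      IsDistanceHereditary G → IsDistanceHereditary (addPendant G u)
  | trueTwin {V : Type u} {G : SimpleGraph V} (u : V) :
      IsDistanceHereditary G → IsDistanceHereditary (addTrueTwin G u)
  | falseTwin {V : Type u} {G : SimpleGraph V} (u : V) :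
      IsDistanceHereditary G → IsDistanceHereditary (addFalseTwin G u)
  | iso {V W : Type u} {G : SimpleGraph V} {H : SimpleGraph W} (e : G ≃g H) :
      IsDistanceHereditary G → IsDistanceHereditary H

/-- Strongly distance-hereditary graphs: true twins may only be added on vertices with exactly
one neighbour, false twins only on vertices whose neighbourhood spans no edge. -/
inductive IsStronglyDistanceHereditary : ∀ {V : Type u}, SimpleGraph V → Prop
  | single : IsStronglyDistanceHereditary (⊥ : SimpleGraph PUnit.{u + 1})
  | pendant {V : Type u} {G : SimpleGraph V} (u : V) :
      IsStronglyDistanceHereditary G → IsStronglyDistanceHereditary (addPendant G u)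
  | trueTwin {V : Type u} {G : SimpleGraph V} (u : V) (hu : (G.neighborSet u).ncard = 1) :
      IsStronglyDistanceHereditary G → IsStronglyDistanceHereditary (addTrueTwin G u)
  | falseTwin {V : Type u} {G : SimpleGraph V} (u : V)
      (hu : ∀ x ∈ G.neighborSet u, ∀ y ∈ G.neighborSet u, ¬ G.Adj x y) :
      IsStronglyDistanceHereditary G → IsStronglyDistanceHereditary (addFalseTwin G u)
  | iso {V W : Type u} {G : SimpleGraph V} {H : SimpleGraph W} (e : G ≃g H) :
      IsStronglyDistanceHereditary G → IsStronglyDistanceHereditary H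

/-! ### Singly connected orientations -/

/-- `p` is the vertex sequence of a directed path (no repeated vertices) from `s` to `t`. -/
def IsDiPath {V : Type u} (D : Digraph V) (s t : V) (p : List V) : Prop :=
  p.IsChain D.Adj ∧ p.Nodup ∧ p.head? = some s ∧ p.getLast? = some t

/-- A digraph is singly connected if there is at most one path from `s` to `t`, for all `s, t`. -/
def IsSinglyConnected {V : Type u} (D : Digraph V) : Prop :=
  ∀ (s t : V) (p q : List V), IsDiPath D s t p → IsDiPath D s t q → p = q

/-- An orientation maps each edge to one of its endpoints, its head. -/
structure EdgeOrientation {V : Type u} (G : SimpleGraph V) where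
  head : G.edgeSet → V
  head_mem : ∀ e : G.edgeSet, head e ∈ (e : Sym2 V)

/-- The digraph defined by an orientation. -/
def EdgeOrientation.toDigraph {V : Type u} {G : SimpleGraph V} (σ : EdgeOrientation G) :
    Digraph V where
  Adj x y := ∃ h : G.Adj x y, σ.head ⟨s(x, y), G.mem_edgeSet.mpr h⟩ = y

/-- A graph is sc-orientable if some orientation of it is singly connected. -/
def IsSCOrientable {V : Type u} (G : SimpleGraph V) : Prop :=
  ∃ σ : EdgeOrientation G, IsSinglyConnected σ.toDigraph

/-! ### Forbidden subgraphs -/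

/-- The diamond: a 4-cycle with one chord. -/
def diamond : SimpleGraph (Fin 4) :=
  SimpleGraph.fromEdgeSet {s(0, 1), s(1, 2), s(2, 3), s(3, 0), s(0, 2)}

/-- The house: a 4-cycle and a fifth vertex adjacent to two consecutive vertices of it. -/
def house : SimpleGraph (Fin 5) :=
  SimpleGraph.fromEdgeSet {s(0, 1), s(1, 2), s(2, 3), s(3, 0), s(2, 4), s(3, 4)}

/-- The domino: the `2 × 3` grid. -/
def domino : SimpleGraph (Fin 6) :=
  SimpleGraph.fromEdgeSet
    {s(0, 1), s(2, 3), s(4, 5), s(0, 2), s(2, 4), s(1, 3), s(3, 5)}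

/-- No induced house, no hole (an induced cycle of length at least 5), no induced domino, and no
diamond as a (not necessarily induced) subgraph. -/
structure IsHHDDFree {V : Type u} (G : SimpleGraph V) : Prop where
  house_free : ¬ house.IsIndContained G
  hole_free : ∀ n : ℕ, 5 ≤ n → ¬ (SimpleGraph.cycleGraph n).IsIndContained G
  domino_free : ¬ domino.IsIndContained G
  diamond_free : ¬ diamond.IsContained G

end SCOrient

/-! The cycle of implications is (1) ⇒ (3) ⇒ (2) ⇒ (1). (1) ⇒ (3): along the construction one
maintains a singly connected orientation in which every vertex on no triangle is a source or a sink
(`IsGoodOrientation`). New pendants and false twins become sources, and an admissible true twin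
closes a cyclic triangle; reversing all arcs reduces to one case. (3) ⇒ (2): house, domino and holes
have neither pendants nor twins, so no operation can create an induced copy. In a singly connected
orientation all triangles are cyclic, which a diamond does not survive. (2) ⇒ (1): by
`exists_pendant_or_twins` some vertex can be removed by undoing an admissible operation. It is found
in the last distance level from a non-isolated root, within the component of the root. The key is
`lower_adj`: two vertices of a level that are adjacent or share an upper neighbour have the same
lower neighbours. -/

namespace SCOrient

open SimpleGraph

/-! ### Adjacency in one-vertex extensions -/

section addVertex

variable {V : Type u} {G : SimpleGraph V} {N : Set V}

@[simp] lemma addVertex_some_some {x y : V} :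
    (addVertex G N).Adj (some x) (some y) ↔ G.Adj x y := Iff.rfl

@[simp] lemma addVertex_some_none {x : V} : (addVertex G N).Adj (some x) none ↔ x ∈ N := Iff.rfl

@[simp] lemma addVertex_none_some {x : V} : (addVertex G N).Adj none (some x) ↔ x ∈ N := Iff.rfl

/-- A graph is the one-vertex extension of the graph with one vertex deleted. -/
noncomputable def addVertexIso (G : SimpleGraph V) (v : V) (N : Set {w // w ≠ v})
    (hN : ∀ w : {w // w ≠ v}, w ∈ N ↔ G.Adj v w) :
    addVertex (G.comap (Subtype.val : {w // w ≠ v} → V)) N ≃g G where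
  toEquiv := by classical exact Equiv.optionSubtypeNe v
  map_rel_iff' := by
    rintro (_ | x) (_ | y)
    · simp
    · simp [hN]
    · simp [hN, G.adj_comm]
    · simp

end addVertex

/-! ### Explicit descriptions of the forbidden subgraphs -/

section patterns

variable {V : Type u} {G : SimpleGraph V}

lemma diamond_isContained_iff : diamond.IsContained G ↔
    ∃ a b c d, G.Adj a b ∧ G.Adj b c ∧ G.Adj c d ∧ G.Adj d a ∧ G.Adj a c ∧ b ≠ d := by
  constructor
  · rintro ⟨f⟩
    have key : ∀ {i j : Fin 4}, diamond.Adj i j → G.Adj (f i) (f j) := fun h => f.toHom.map_adj h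
    refine ⟨f 0, f 1, f 2, f 3, key ?_, key ?_, key ?_, key ?_, key ?_, ?_⟩
    any_goals simp [diamond]
    exact fun h => absurd (f.injective h) (by decide)
  · rintro ⟨a, b, c, d, hab, hbc, hcd, hda, hac, hbd⟩
    refine ⟨⟨⟨![a, b, c, d], ?_⟩, ?_⟩⟩
    · intro i j
      fin_cases i <;> fin_cases j <;> simp [diamond] <;> grind [G.adj_comm]
    · intro i j
      have := hab.ne; have := hbc.ne; have := hcd.ne; have := hda.ne; have := hac.ne
      fin_cases i <;> fin_cases j <;> simp <;> grind

lemma house_isIndContained {a b c d e : V} (hab : G.Adj a b) (hbc : G.Adj b c) (hcd : G.Adj c d)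
    (hda : G.Adj d a) (hce : G.Adj c e) (hde : G.Adj d e) (hac : ¬ G.Adj a c)
    (hbd : ¬ G.Adj b d) (hae : ¬ G.Adj a e) (hbe : ¬ G.Adj b e) : house.IsIndContained G := by
  have H : ∀ i j : Fin 5, G.Adj (![a, b, c, d, e] i) (![a, b, c, d, e] j) ↔ house.Adj i j := by
    intro i j
    fin_cases i <;> fin_cases j <;> simp [house] <;> grind [G.adj_comm, G.irrefl]
  refine ⟨⟨⟨![a, b, c, d, e], ?_⟩, @H⟩⟩
  intro i j
  fin_cases i <;> fin_cases j <;> simp <;> grind [G.adj_comm, G.irrefl]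

lemma domino_isIndContained {a b c d e f : V} (hab : G.Adj a b) (hcd : G.Adj c d)
    (hef : G.Adj e f) (hac : G.Adj a c) (hce : G.Adj c e) (hbd : G.Adj b d) (hdf : G.Adj d f)
    (had : ¬ G.Adj a d) (hae : ¬ G.Adj a e) (haf : ¬ G.Adj a f) (hbc : ¬ G.Adj b c)
    (hbe : ¬ G.Adj b e) (hbf : ¬ G.Adj b f) (hcf : ¬ G.Adj c f) (hde : ¬ G.Adj d e)
    (hne : a ≠ f) (hne2 : b ≠ e) : domino.IsIndContained G := by
  have H : ∀ i j : Fin 6,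
      G.Adj (![a, b, c, d, e, f] i) (![a, b, c, d, e, f] j) ↔ domino.Adj i j := by
    intro i j
    fin_cases i <;> fin_cases j <;> simp [domino] <;> grind [G.adj_comm, G.irrefl]
  refine ⟨⟨⟨![a, b, c, d, e, f], ?_⟩, @H⟩⟩
  intro i j
  fin_cases i <;> fin_cases j <;> simp <;> grind [G.adj_comm, G.irrefl]

end patterns

/-! ### Graphs without pendant vertices and twins -/

/-- Every vertex has two neighbours and every two vertices are distinguished by a third one. -/
structure IsTwinFree {W : Type*} (H : SimpleGraph W) : Prop where
  nonempty : Nonempty W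
  exists_two_adj : ∀ x, ∃ y z, y ≠ z ∧ H.Adj x y ∧ H.Adj x z
  exists_distinguishing : ∀ x y, x ≠ y → ∃ z, z ≠ x ∧ z ≠ y ∧ ¬ (H.Adj x z ↔ H.Adj y z)

instance : DecidableRel house.Adj := fun i j =>
  decidable_of_iff (s(i, j) ∈ ({s(0, 1), s(1, 2), s(2, 3), s(3, 0), s(2, 4), s(3, 4)} :
    Finset (Sym2 (Fin 5))) ∧ i ≠ j) (by simp [house])

instance : DecidableRel domino.Adj := fun i j =>
  decidable_of_iff (s(i, j) ∈ ({s(0, 1), s(2, 3), s(4, 5), s(0, 2), s(2, 4), s(1, 3), s(3, 5)} :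
    Finset (Sym2 (Fin 6))) ∧ i ≠ j) (by simp [domino])

lemma house_isTwinFree : IsTwinFree house := ⟨⟨0⟩, by decide, by decide⟩

lemma domino_isTwinFree : IsTwinFree domino := ⟨⟨0⟩, by decide, by decide⟩

lemma cycleGraph_adj_iff_val {n : ℕ} (hn : 2 ≤ n) {i j : Fin n} : (cycleGraph n).Adj i j ↔
    i.val + 1 = j ∨ j.val + 1 = i ∨ (i.val = 0 ∧ j.val + 1 = n) ∨ (j.val = 0 ∧ i.val + 1 = n) := by
  rw [cycleGraph_adj']
  have hi := i.isLt
  have hj := j.isLt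
  rcases lt_trichotomy i j with h | h | h
  · rw [Fin.sub_val_of_le h.le, Fin.coe_sub_iff_lt.2 h]
    have := Fin.lt_def.1 h
    omega
  · subst h
    simp only [Fin.coe_sub_iff_le.2 le_rfl]
    omega
  · rw [Fin.sub_val_of_le h.le, Fin.coe_sub_iff_lt.2 h]
    have := Fin.lt_def.1 h
    omega

lemma cycleGraph_isTwinFree {n : ℕ} (hn : 5 ≤ n) : IsTwinFree (cycleGraph n) := by
  have adj := fun i j : Fin n => cycleGraph_adj_iff_val (i := i) (j := j) (by omega : 2 ≤ n)
  have succ : ∀ i : Fin n, ∃ j : Fin n,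
      (i.val + 1 = j ∧ i.val + 1 < n) ∨ (j.val = 0 ∧ i.val + 1 = n) := by
    intro i
    by_cases h : i.val + 1 < n
    · exact ⟨⟨i + 1, h⟩, Or.inl ⟨rfl, h⟩⟩
    · exact ⟨⟨0, by omega⟩, Or.inr ⟨rfl, by omega⟩⟩
  have pred : ∀ i : Fin n, ∃ j : Fin n,
      (j.val + 1 = i ∧ 0 < i.val) ∨ (i.val = 0 ∧ j.val + 1 = n) := by
    intro i
    by_cases h : 0 < i.val
    · exact ⟨⟨i - 1, by omega⟩, Or.inl ⟨by simp only; omega, h⟩⟩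
    · exact ⟨⟨n - 1, by omega⟩, Or.inr ⟨by omega, by simp only; omega⟩⟩
  refine ⟨⟨⟨0, by omega⟩⟩, fun x => ?_, fun x y hxy => ?_⟩
  · obtain ⟨y, hy⟩ := succ x
    obtain ⟨z, hz⟩ := pred x
    refine ⟨y, z, fun h => ?_, (adj _ _).2 ?_, (adj _ _).2 ?_⟩
    · subst h; omega
    · omega
    · omega
  · obtain ⟨a, ha⟩ := succ x
    obtain ⟨b, hb⟩ := pred x
    have hx := x.isLt
    have hy := y.isLt
    have hxa : (cycleGraph n).Adj x a := (adj _ _).2 (by omega)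
    have hxb : (cycleGraph n).Adj x b := (adj _ _).2 (by omega)
    have hxy' : x.val ≠ y.val := fun h => hxy (Fin.ext h)
    -- If both cyclic neighbours of `x` were equal or adjacent to `y`, there would be a cycle of
    -- length at most four.
    by_cases h : a = y ∨ (cycleGraph n).Adj y a
    · have h' : ¬ (b = y ∨ (cycleGraph n).Adj y b) := by
        rw [adj, Fin.ext_iff] at h ⊢
        rcases h with h | h | h | h | h <;> omega
      exact ⟨b, hxb.ne', fun e => h' (Or.inl e), fun e => h' (Or.inr (e.1 hxb))⟩
    · exact ⟨a, hxa.ne', fun e => h (Or.inl e), fun e => h (Or.inr (e.1 hxa))⟩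

/-! ### Induced subgraphs of distance-hereditary graphs -/

section

variable {V : Type u} {G : SimpleGraph V} {W : Type*} {H : SimpleGraph W}

/-- An embedding into a one-vertex extension that misses the new vertex or the vertex `u` yields an
embedding into the original graph, if the new vertex is a twin of `u`. -/
lemma isIndContained_of_addVertex {N : Set V} {u : V} (f : H ↪g addVertex G N)
    (hN : none ∈ Set.range f → some u ∉ Set.range f ∧ ∀ w ≠ u, w ∈ N ↔ G.Adj u w) :
    H.IsIndContained G := by
  -- `getD u` puts `u` in the place of the new vertex.
  have inj : ∀ x y, (f x).getD u = (f y).getD u → x = y := by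
    intro x y h
    apply f.injective
    rcases hx : f x with _ | a <;> rcases hy : f y with _ | b <;> simp only [hx, hy] at h ⊢
    · exact absurd ⟨y, hy.trans (congrArg some h.symm)⟩ (hN ⟨x, hx⟩).1
    · exact absurd ⟨x, hx.trans (congrArg some h)⟩ (hN ⟨y, hy⟩).1
    · exact congrArg some h
  refine ⟨⟨⟨fun x => (f x).getD u, inj⟩, ?_⟩⟩
  intro x y
  rw [← f.map_adj_iff]
  change G.Adj ((f x).getD u) ((f y).getD u) ↔ _
  rcases hx : f x with _ | a <;> rcases hy : f y with _ | b
  · simp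
  · have h := hN ⟨x, hx⟩
    have hb : b ≠ u := by rintro rfl; exact h.1 ⟨y, hy⟩
    simp [h.2 b hb]
  · have h := hN ⟨y, hy⟩
    have hb : a ≠ u := by rintro rfl; exact h.1 ⟨x, hx⟩
    simp [h.2 a hb, G.adj_comm]
  · simp

/-- No third vertex tells the new vertex from `u`, so a copy of `H` cannot use both. The hypothesis
says nothing about `w = u` and so covers true and false twins alike. -/
lemma IsTwinFree.isIndContained_of_twin (hH : IsTwinFree H) {N : Set V} {u : V}
    (hN : ∀ w ≠ u, w ∈ N ↔ G.Adj u w) (h : H.IsIndContained (addVertex G N)) :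
    H.IsIndContained G := by
  obtain ⟨f⟩ := h
  refine isIndContained_of_addVertex (u := u) f fun ⟨x, hx⟩ => ⟨?_, hN⟩
  rintro ⟨y, hy⟩
  obtain ⟨z, hzx, hzy, hz⟩ := hH.exists_distinguishing x y (by rintro rfl; simp [hx] at hy)
  apply hz
  rw [← f.map_adj_iff, ← f.map_adj_iff, hx, hy]
  rcases hw : f z with _ | w
  · exact absurd (f.injective (hw.trans hx.symm)) hzx
  · simp only [addVertex_none_some, addVertex_some_some]
    exact hN w (by rintro rfl; exact hzy (f.injective (hw.trans hy.symm)))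

/-- A vertex of `H` placed on the pendant would have two neighbours, both placed on `u`. -/
lemma IsTwinFree.isIndContained_of_pendant (hH : IsTwinFree H) {u : V}
    (h : H.IsIndContained (addPendant G u)) : H.IsIndContained G := by
  obtain ⟨f : H ↪g addVertex G {u}⟩ := h
  refine isIndContained_of_addVertex (u := u) f fun ⟨x, hx⟩ => False.elim ?_
  obtain ⟨y, z, hyz, hy, hz⟩ := hH.exists_two_adj x
  have key : ∀ w, H.Adj x w → f w = some u := by
    intro w hw
    rw [← f.map_adj_iff, hx] at hw
    rcases hfw : f w with _ | w'
    · rw [hfw] at hw; exact absurd hw (SimpleGraph.irrefl _)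
    · rw [hfw] at hw; exact congrArg some hw
  exact hyz (f.injective ((key y hy).trans (key z hz).symm))

lemma IsDistanceHereditary.not_isIndContained (hG : IsDistanceHereditary G) (hH : IsTwinFree H) :
    ¬ H.IsIndContained G := by
  induction hG with
  | single =>
    rintro ⟨f⟩
    obtain ⟨x⟩ := hH.nonempty
    obtain ⟨y, z, hyz, -⟩ := hH.exists_two_adj x
    exact hyz (f.injective (Subsingleton.elim _ _))
  | pendant u _ ih => exact fun h => ih (hH.isIndContained_of_pendant h)
  | trueTwin u _ ih =>
    exact fun h => ih (hH.isIndContained_of_twin (u := u) (fun w hw => by simp [hw]) h)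
  | falseTwin u _ ih =>
    exact fun h => ih (hH.isIndContained_of_twin (u := u) (fun w hw => by simp) h)
  | iso e _ ih => exact fun h => ih (h.trans ⟨e.symm.toEmbedding⟩)

lemma IsDistanceHereditary.isHHDDFree (hG : IsDistanceHereditary G)
    (hd : ¬ diamond.IsContained G) : IsHHDDFree G where
  house_free := hG.not_isIndContained house_isTwinFree
  hole_free _ hn := hG.not_isIndContained (cycleGraph_isTwinFree hn)
  domino_free := hG.not_isIndContained domino_isTwinFree
  diamond_free := hd

lemma IsStronglyDistanceHereditary.isDistanceHereditary (hG : IsStronglyDistanceHereditary G) :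
    IsDistanceHereditary G := by
  induction hG with
  | single => exact .single
  | pendant u _ ih => exact .pendant u ih
  | trueTwin u _ _ ih => exact .trueTwin u ih
  | falseTwin u _ _ ih => exact .falseTwin u ih
  | iso e _ ih => exact .iso e ih

end

/-! ### Diamonds in singly connected orientations -/

section

variable {V : Type u} {G : SimpleGraph V}

lemma EdgeOrientation.adj_or_adj (σ : EdgeOrientation G) {x y : V} (h : G.Adj x y) :
    σ.toDigraph.Adj x y ∨ σ.toDigraph.Adj y x := by
  rcases Sym2.mem_iff.1 (σ.head_mem ⟨s(x, y), h⟩) with e | e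
  · exact Or.inr ⟨h.symm, (congrArg σ.head (Subtype.ext Sym2.eq_swap)).trans e⟩
  · exact Or.inl ⟨h, e⟩

/-- Otherwise the arc and the path through `y` are two paths from `x` to `z`. Hence triangles are
oriented cyclically. -/
lemma IsSinglyConnected.not_transitive {D : Digraph V} (hD : IsSinglyConnected D) {x y z : V}
    (hxy : D.Adj x y) (hyz : D.Adj y z) (h1 : x ≠ y) (h2 : y ≠ z) (h3 : x ≠ z) :
    ¬ D.Adj x z := by
  intro hxz
  have := hD x z [x, y, z] [x, z] (by simp [IsDiPath, *]) (by simp [IsDiPath, *])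
  simp at this

/-- If the chord points from `a` to `c`, cyclicity of both triangles yields the two paths `c, b, a`
and `c, d, a`. -/
lemma IsSCOrientable.not_diamond_isContained (hG : IsSCOrientable G) :
    ¬ diamond.IsContained G := by
  rw [diamond_isContained_iff]
  rintro ⟨a, b, c, d, hab, hbc, hcd, hda, hac, hbd⟩
  obtain ⟨σ, hσ⟩ := hG
  wlog h : σ.toDigraph.Adj a c generalizing a c
  · exact this c a hbc.symm hab.symm hda.symm hcd.symm hac.symm
      ((σ.adj_or_adj hac).resolve_left h)
  have cyc : ∀ x, G.Adj a x → G.Adj c x → σ.toDigraph.Adj c x ∧ σ.toDigraph.Adj x a := by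
    intro x hax hcx
    have hca : σ.toDigraph.Adj c x := by
      refine (σ.adj_or_adj hcx).resolve_right fun hxc => ?_
      rcases σ.adj_or_adj hax with h' | h'
      · exact hσ.not_transitive h' hxc hax.ne hcx.ne' hac.ne h
      · exact hσ.not_transitive h' h hax.ne' hac.ne hcx.ne' hxc
    exact ⟨hca, (σ.adj_or_adj hax).resolve_left
      (hσ.not_transitive h hca hac.ne hcx.ne hax.ne)⟩
  have hb := cyc b hab hbc.symm
  have hd := cyc d hda.symm hcd
  have := hσ c a [c, b, a] [c, d, a]
    (by simp [IsDiPath, hb, hbc.ne', hab.ne', hac.ne'])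
    (by simp [IsDiPath, hd, hcd.ne, hda.ne, hac.ne'])
  simp [hbd] at this

lemma IsDistanceHereditary.isHHDDFree_of_isSCOrientable (hG : IsDistanceHereditary G)
    (h : IsSCOrientable G) : IsHHDDFree G :=
  hG.isHHDDFree h.not_diamond_isContained

end

/-! ### Singly connected digraphs -/

section

variable {V : Type u} {D : Digraph V}

/-- The digraph with all arcs reversed. -/
def reverseDigraph (D : Digraph V) : Digraph V where
  Adj x y := D.Adj y x

lemma IsDiPath.reverse {s t : V} {p : List V} (h : IsDiPath (reverseDigraph D) s t p) :
    IsDiPath D t s p.reverse := by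
  obtain ⟨h1, h2, h3, h4⟩ := h
  refine ⟨List.isChain_reverse.2 h1, List.nodup_reverse.2 h2, ?_, ?_⟩
  · rw [List.head?_reverse, h4]
  · rw [List.getLast?_reverse, h3]

lemma IsSinglyConnected.reverse (h : IsSinglyConnected D) :
    IsSinglyConnected (reverseDigraph D) := fun s t _ _ hp hq =>
  List.reverse_injective (h t s _ _ hp.reverse hq.reverse)

/-- The digraph obtained by adding a new vertex with the given in- and out-neighbours. -/
def addVertexDigraph (D : Digraph V) (I O : Set V) : Digraph (Option V) where
  Adj
    | some x, some y => D.Adj x y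
    | some x, none => x ∈ I
    | none, some y => y ∈ O
    | none, none => False

variable {I O : Set V}

lemma isDiPath_map_some {s t : V} {l : List V}
    (h : IsDiPath (addVertexDigraph D I O) (some s) (some t) (l.map some)) : IsDiPath D s t l := by
  obtain ⟨h1, h2, h3, h4⟩ := h
  refine ⟨(List.isChain_map some).1 h1, h2.of_map, ?_, ?_⟩
  · simpa using h3
  · simpa using h4

lemma exists_eq_map_some {l : List (Option V)} (h : none ∉ l) : ∃ l₀ : List V, l = l₀.map some := by
  induction l with
  | nil => exact ⟨[], rfl⟩
  | cons a l ih =>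
    obtain ⟨l₀, rfl⟩ := ih (fun h' => h (List.mem_cons_of_mem _ h'))
    cases a with
    | none => simp at h
    | some a => exact ⟨a :: l₀, rfl⟩

/-- A path avoids the new vertex, or it splits there into a path to an in-neighbour (possibly
empty) and a path from an out-neighbour (possibly empty). -/
lemma exists_of_isChain_addVertexDigraph {p : List (Option V)}
    (h : p.IsChain (addVertexDigraph D I O).Adj) (hp : p.Nodup) :
    (∃ l : List V, p = l.map some) ∨ ∃ A B : List V, p = A.map some ++ none :: B.map some ∧
      A.IsChain D.Adj ∧ B.IsChain D.Adj ∧ (A ++ B).Nodup ∧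
      (∀ x ∈ A.getLast?, x ∈ I) ∧ (∀ x ∈ B.head?, x ∈ O) := by
  by_cases hn : none ∈ p
  · right
    obtain ⟨A', B', rfl⟩ := List.append_of_mem hn
    have hd := List.nodup_append.1 hp
    obtain ⟨A, rfl⟩ := exists_eq_map_some (l := A') (fun h' => hd.2.2 _ h' none (by simp) rfl)
    obtain ⟨B, rfl⟩ := exists_eq_map_some (l := B') (List.nodup_cons.1 hd.2.1).1
    have hc := List.isChain_append.1 h
    refine ⟨A, B, rfl, (List.isChain_map some).1 hc.1,
      (List.isChain_map some).1 hc.2.1.tail, ?_, ?_, ?_⟩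
    · have : ((A ++ B).map some).Nodup := by
        rw [List.map_append]
        exact hp.sublist (List.Sublist.append_left (List.sublist_cons_self _ _) _)
      exact this.of_map
    · intro x hx
      exact hc.2.2 (some x) (by simpa using hx) none (by simp)
    · intro x hx
      exact (List.isChain_cons.1 hc.2.1).1 (some x) (by simpa using hx)
  · exact Or.inl (exists_eq_map_some hn)

/-- Adding a source preserves single connectedness if the paths from its out-neighbours to any
given vertex are unique. -/
lemma IsSinglyConnected.addSource (hD : IsSinglyConnected D)
    (hO : ∀ a ∈ O, ∀ b ∈ O, ∀ t p q, IsDiPath D a t p → IsDiPath D b t q → p = q) :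
    IsSinglyConnected (addVertexDigraph D ∅ O) := by
  have key : ∀ s t p, IsDiPath (addVertexDigraph D ∅ O) s t p →
      (∃ s₀ t₀ l, s = some s₀ ∧ t = some t₀ ∧ p = l.map some ∧ IsDiPath D s₀ t₀ l) ∨
      (s = none ∧ t = none ∧ p = [none]) ∨
      (∃ a ∈ O, ∃ t₀ l, s = none ∧ t = some t₀ ∧ p = none :: l.map some ∧ IsDiPath D a t₀ l) := by
    intro s t p hp
    rcases exists_of_isChain_addVertexDigraph hp.1 hp.2.1 with ⟨l, rfl⟩ | ⟨A, B, rfl, -, hB, hn, hA', hB'⟩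
    · left
      have h3 := hp.2.2.1
      have h4 := hp.2.2.2
      simp only [List.head?_map, List.getLast?_map, Option.map_eq_some_iff] at h3 h4
      obtain ⟨s₀, -, rfl⟩ := h3
      obtain ⟨t₀, -, rfl⟩ := h4
      exact ⟨s₀, t₀, l, rfl, rfl, rfl, isDiPath_map_some hp⟩
    -- Nothing enters the new vertex, so it can only be the start of a path.
    · have hA : A = [] := by
        rcases hx : A.getLast? with _ | x
        · simpa using hx
        · exact absurd (hA' x hx) (by simp)
      subst hA
      obtain ⟨-, -, h3, h4⟩ := hp
      right
      cases B with
      | nil =>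
        left
        simp at h3 h4
        exact ⟨h3.symm, h4.symm, rfl⟩
      | cons b B =>
        right
        have : none :: (b :: B).map some = [none] ++ (b :: B).map some := rfl
        simp only [List.map_nil, List.nil_append, this, List.getLast?_append] at h4
        obtain ⟨t₀, ht₀⟩ : ∃ t₀, (b :: B).getLast? = some t₀ :=
          ⟨_, List.getLast?_eq_some_getLast (by simp)⟩
        rw [List.getLast?_map, ht₀] at h4
        simp at h3 h4
        exact ⟨b, hB' b rfl, t₀, b :: B, h3.symm, h4.symm, rfl, hB, by simpa using hn, rfl, ht₀⟩
  intro s t p q hp hq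
  rcases key s t p hp with ⟨s₀, t₀, l, rfl, rfl, rfl, h⟩ | ⟨rfl, rfl, rfl⟩ | ⟨a, ha, t₀, l, rfl, rfl, rfl, h⟩ <;>
  rcases key _ _ q hq with ⟨s₁, t₁, m, e₁, e₂, rfl, h'⟩ | ⟨e₁, e₂, rfl⟩ | ⟨b, hb, t₁, m, e₁, e₂, rfl, h'⟩ <;>
  simp only [Option.some.injEq, reduceCtorEq] at e₁ e₂
  · subst e₁ e₂
    rw [hD _ _ _ _ h h']
  · rfl
  · subst e₂
    rw [hO a ha b hb _ _ _ h h']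

/-- Completing an arc from a source `u` with unique out-neighbour `w` to a cyclic triangle preserves
single connectedness. -/
lemma IsSinglyConnected.addTriangle (hD : IsSinglyConnected D) {u w : V}
    (hin : ∀ y, ¬ D.Adj y u) (hout : ∀ y, D.Adj u y → y = w) :
    IsSinglyConnected (addVertexDigraph D {w} {u}) := by
  have key : ∀ s t p, IsDiPath (addVertexDigraph D {w} {u}) s t p →
      (∃ s₀ t₀ l, s = some s₀ ∧ t = some t₀ ∧ p = l.map some ∧ IsDiPath D s₀ t₀ l) ∨
      (s = none ∧ t = none ∧ p = [none]) ∨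
      (∃ s₀ l, s = some s₀ ∧ t = none ∧ p = l.map some ++ [none] ∧ IsDiPath D s₀ w l) ∨
      (∃ s₀ l, s = some s₀ ∧ t = some u ∧ p = l.map some ++ [none, some u] ∧ s₀ ≠ u ∧
        IsDiPath D s₀ w l) ∨
      (∃ t₀ l, s = none ∧ t = some t₀ ∧ p = none :: l.map some ∧ IsDiPath D u t₀ l) := by
    intro s t p hp
    rcases exists_of_isChain_addVertexDigraph hp.1 hp.2.1 with
      ⟨l, rfl⟩ | ⟨A, B, rfl, hA, hB, hn, hA', hB'⟩
    · left
      have h3 := hp.2.2.1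
      have h4 := hp.2.2.2
      simp only [List.head?_map, List.getLast?_map, Option.map_eq_some_iff] at h3 h4
      obtain ⟨s₀, -, rfl⟩ := h3
      obtain ⟨t₀, -, rfl⟩ := h4
      exact ⟨s₀, t₀, l, rfl, rfl, rfl, isDiPath_map_some hp⟩
    · right
      obtain ⟨-, -, h3, h4⟩ := hp
      have hnd := List.nodup_append.1 hn
      have hAw : A ≠ [] → A.getLast? = some w := fun h => by
        have := hA' _ (List.getLast?_eq_some_getLast h)
        rw [List.getLast?_eq_some_getLast h, this]
      have hs : ∀ a A₁, A = a :: A₁ → s = some a := by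
        rintro a A₁ rfl; simpa using h3.symm
      rcases A with _ | ⟨a, A₁⟩
      · rcases B with _ | ⟨b, B₁⟩
        · left; simp at h3 h4; exact ⟨h3.symm, h4.symm, rfl⟩
        · obtain rfl : b = u := hB' b rfl
          right; right; right
          have : none :: (b :: B₁).map some = [none] ++ (b :: B₁).map some := rfl
          simp only [List.map_nil, List.nil_append, this, List.getLast?_append] at h4
          obtain ⟨t₀, ht₀⟩ : ∃ t₀, (b :: B₁).getLast? = some t₀ :=
            ⟨_, List.getLast?_eq_some_getLast (by simp)⟩
          rw [List.getLast?_map, ht₀] at h4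
          simp at h3 h4
          exact ⟨t₀, b :: B₁, h3.symm, h4.symm, rfl, hB, hnd.2.1, rfl, ht₀⟩
      · have hs' := hs a A₁ rfl
        have hw := hAw (by simp)
        rcases B with _ | ⟨b, B₁⟩
        · right; left
          rw [List.getLast?_append] at h4
          simp at h4
          exact ⟨a, a :: A₁, hs', h4.symm, rfl, hA, hnd.1, rfl, hw⟩
        · obtain rfl : b = u := hB' b rfl
          -- After `u` the path could only continue to `w`, which it has already visited on its way
          -- to the new vertex.
          have : B₁ = [] := by
            rcases B₁ with _ | ⟨c, B₂⟩
            · rfl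
            · obtain rfl : c = w := hout c (List.isChain_cons_cons.1 hB).1
              exact absurd rfl (hnd.2.2 c (List.mem_of_getLast? hw) c (by simp))
          subst this
          right; right; left
          rw [List.getLast?_append] at h4
          simp at h4
          exact ⟨a, a :: A₁, hs', h4.symm, rfl, hnd.2.2 a (by simp) b (by simp), hA, hnd.1, rfl, hw⟩
  -- As `u` is a source of `D`, it is reached from another old vertex only through the new one; this
  -- rules out two paths of different shapes with the same ends.
  have nopath : ∀ s l, s ≠ u → ¬ IsDiPath D s u l := by
    rintro s l hs ⟨h1, -, h3, h4⟩
    obtain ⟨l', rfl⟩ := List.getLast?_eq_some_iff.1 h4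
    rcases hl : l'.getLast? with _ | x
    · rw [List.getLast?_eq_none_iff] at hl
      subst hl
      simp at h3
      exact hs h3.symm
    · exact hin x ((List.isChain_append.1 h1).2.2 x hl u rfl)
  intro s t p q hp hq
  rcases key s t p hp with ⟨s₀, t₀, l, rfl, rfl, rfl, h⟩ | ⟨rfl, rfl, rfl⟩ | ⟨s₀, l, rfl, rfl, rfl, h⟩ |
    ⟨s₀, l, rfl, rfl, rfl, hs, h⟩ | ⟨t₀, l, rfl, rfl, rfl, h⟩ <;>
  rcases key _ _ q hq with ⟨s₁, t₁, m, e₁, e₂, rfl, h'⟩ | ⟨e₁, e₂, rfl⟩ | ⟨s₁, m, e₁, e₂, rfl, h'⟩ |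
    ⟨s₁, m, e₁, e₂, rfl, hs', h'⟩ | ⟨t₁, m, e₁, e₂, rfl, h'⟩ <;>
  simp only [Option.some.injEq, reduceCtorEq] at e₁ e₂
  · subst e₁ e₂
    rw [hD _ _ _ _ h h']
  · subst e₁ e₂
    exact absurd h (nopath _ _ hs')
  · rfl
  · subst e₁
    rw [hD _ _ _ _ h h']
  · subst e₁ e₂
    exact absurd h' (nopath _ _ hs)
  · subst e₁
    rw [hD _ _ _ _ h h']
  · subst e₂
    rw [hD _ _ _ _ h h']

end

/-! ### Orientations of strongly distance-hereditary graphs -/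

section

variable {V : Type u} {G : SimpleGraph V} {D : Digraph V}

/-- The neighbourhood of `u` spans no edge. -/
def HasIndepNbhd (G : SimpleGraph V) (u : V) : Prop :=
  ∀ x ∈ G.neighborSet u, ∀ y ∈ G.neighborSet u, ¬ G.Adj x y

/-- `D` is a singly connected orientation of `G` in which every vertex that lies on no triangle is a
source or a sink. -/
structure IsGoodOrientation (G : SimpleGraph V) (D : Digraph V) : Prop where
  adj : ∀ {x y}, D.Adj x y → G.Adj x y
  adj_or : ∀ {x y}, G.Adj x y → D.Adj x y ∨ D.Adj y x
  asymm : ∀ {x y}, D.Adj x y → ¬ D.Adj y x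
  sc : IsSinglyConnected D
  source_or_sink : ∀ u, HasIndepNbhd G u → (∀ y, ¬ D.Adj y u) ∨ ∀ y, ¬ D.Adj u y

/-- The invariant is symmetric, so a vertex on no triangle may be assumed to be a source, or a sink,
as convenient. -/
lemma IsGoodOrientation.reverse (h : IsGoodOrientation G D) :
    IsGoodOrientation G (reverseDigraph D) where
  adj h' := (h.adj h').symm
  adj_or h' := (h.adj_or h').symm
  asymm h' := h.asymm h'
  sc := h.sc.reverse
  source_or_sink u hu := (h.source_or_sink u hu).symm

/-- Asymmetry makes the head of an edge unique, so choosing heads recovers exactly `D`. -/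
lemma IsGoodOrientation.isSCOrientable (h : IsGoodOrientation G D) : IsSCOrientable G := by
  have ex : ∀ e : G.edgeSet, ∃ y, ∃ x, (e : Sym2 V) = s(x, y) ∧ D.Adj x y := by
    rintro ⟨e, he⟩
    induction e with
    | _ x y =>
      rcases h.adj_or (G.mem_edgeSet.1 he) with h' | h'
      · exact ⟨y, x, rfl, h'⟩
      · exact ⟨x, y, Sym2.eq_swap, h'⟩
  choose f g hfg hD using ex
  let σ : EdgeOrientation G := ⟨f, fun e => by rw [hfg e]; exact Sym2.mem_mk_right _ _⟩
  have : σ.toDigraph = D := by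
    ext x y
    constructor
    · rintro ⟨hxy, e⟩
      have h1 := hfg ⟨s(x, y), G.mem_edgeSet.2 hxy⟩
      have h2 := hD ⟨s(x, y), G.mem_edgeSet.2 hxy⟩
      change f _ = y at e
      rw [e] at h1 h2
      rw [Sym2.congr_left.1 h1]
      exact h2
    · intro hxy
      refine ⟨h.adj hxy, ?_⟩
      have h1 := hfg ⟨s(x, y), G.mem_edgeSet.2 (h.adj hxy)⟩
      have h2 := hD ⟨s(x, y), G.mem_edgeSet.2 (h.adj hxy)⟩
      rcases Sym2.eq_iff.1 h1 with ⟨-, e⟩ | ⟨e1, e2⟩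
      · exact e.symm
      · rw [← e1, ← e2] at h2
        exact absurd h2 (h.asymm hxy)
  exact ⟨σ, this ▸ h.sc⟩

lemma HasIndepNbhd.of_addVertex {N : Set V} {x : V} (h : HasIndepNbhd (addVertex G N) (some x)) :
    HasIndepNbhd G x := fun y hy z hz => h (some y) hy (some z) hz

/-- Each vertex of `N` receives an arc, so if it lies on no triangle it has to be a sink; this is
what `hs` provides. -/
lemma IsGoodOrientation.addSource (h : IsGoodOrientation G D) {N : Set V}
    (hN : ∀ a ∈ N, ∀ b ∈ N, ∀ t p q, IsDiPath D a t p → IsDiPath D b t q → p = q)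
    (hs : ∀ x ∈ N, HasIndepNbhd G x → ∀ y, ¬ D.Adj x y) :
    IsGoodOrientation (addVertex G N) (addVertexDigraph D ∅ N) where
  adj {x y} h' := by
    rcases x with _ | x <;> rcases y with _ | y
    · exact h'.elim
    · exact h'
    · exact h'.elim
    · exact h.adj h'
  adj_or {x y} h' := by
    rcases x with _ | x <;> rcases y with _ | y
    · exact h'.elim
    · exact Or.inl h'
    · exact Or.inr h'
    · exact h.adj_or h'
  asymm {x y} h' := by
    rcases x with _ | x <;> rcases y with _ | y
    · exact h'.elim
    · exact id
    · exact h'.elim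
    · exact h.asymm h'
  sc := h.sc.addSource hN
  source_or_sink x hx := by
    rcases x with _ | x
    · left
      rintro (_ | y) h'
      · exact h'
      · exact h'
    · by_cases hxN : x ∈ N
      · right
        rintro (_ | y) h'
        · exact h'
        · exact hs x hxN hx.of_addVertex y h'
      · rcases h.source_or_sink x hx.of_addVertex with h1 | h1
        · left
          rintro (_ | y) h'
          · exact hxN h'
          · exact h1 y h'
        · right
          rintro (_ | y) h'
          · exact h'
          · exact h1 y h'

/-- The new vertex becomes a source pointing to `u`, after a reversal that makes `u` a sink if it
lies on no triangle. -/
lemma IsGoodOrientation.exists_addPendant (h : IsGoodOrientation G D) (u : V) :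
    ∃ D', IsGoodOrientation (addPendant G u) D' := by
  have key : ∀ {D : Digraph V}, IsGoodOrientation G D →
      (HasIndepNbhd G u → ∀ y, ¬ D.Adj u y) → ∃ D', IsGoodOrientation (addPendant G u) D' := by
    intro D h hu
    refine ⟨_, h.addSource (N := {u}) ?_ ?_⟩
    · rintro a rfl b rfl t p q hp hq
      exact h.sc _ _ _ _ hp hq
    · rintro x rfl
      exact hu
  by_cases hu : HasIndepNbhd G u
  · rcases h.source_or_sink u hu with h' | h'
    · exact key h.reverse fun _ => h'
    · exact key h fun _ => h'
  · exact key h fun h' => absurd h' hu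

/-- With `u` a source, the twin is made a source too. Prefixing `u` turns paths from neighbours of
`u` into paths from `u`, and these are unique. -/
lemma IsGoodOrientation.exists_addFalseTwin (h : IsGoodOrientation G D) {u : V}
    (hu : HasIndepNbhd G u) : ∃ D', IsGoodOrientation (addFalseTwin G u) D' := by
  wlog hsrc : ∀ y, ¬ D.Adj y u generalizing D
  · exact this h.reverse ((h.source_or_sink u hu).resolve_left hsrc)
  have hadj : ∀ a ∈ G.neighborSet u, D.Adj u a := fun a ha =>
    (h.adj_or ha).resolve_right (hsrc a)
  have hpath : ∀ a ∈ G.neighborSet u, ∀ t p, IsDiPath D a t p → IsDiPath D u t (u :: p) := by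
    rintro a ha t p ⟨h1, h2, h3, h4⟩
    have hup : u ∉ p := by
      intro hmem
      obtain ⟨A, B, rfl⟩ := List.append_of_mem hmem
      rcases hA : A.getLast? with _ | x
      · rw [List.getLast?_eq_none_iff] at hA
        subst hA
        simp at h3
        exact G.irrefl (h3 ▸ ha)
      · exact hsrc x ((List.isChain_append.1 h1).2.2 x hA u rfl)
    refine ⟨List.isChain_cons.2 ⟨fun y hy => ?_, h1⟩, List.nodup_cons.2 ⟨hup, h2⟩, rfl, ?_⟩
    · rw [h3] at hy
      obtain rfl := Option.some_injective _ hy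
      exact hadj _ ha
    · rw [List.getLast?_cons, h4]; rfl
  refine ⟨_, h.addSource (N := G.neighborSet u) ?_ ?_⟩
  · intro a ha b hb t p q hp hq
    exact (List.cons.inj (h.sc _ _ _ _ (hpath a ha t p hp) (hpath b hb t q hq))).2
  · intro x hx hi
    exact (h.source_or_sink x hi).resolve_left fun h' => h' u (hadj x hx)

/-- With `u` a source, the arcs from `w` to the twin and from the twin to `u` close a cyclic
triangle. Its vertices are then exempt from the source-or-sink condition. -/
lemma IsGoodOrientation.exists_addTrueTwin (h : IsGoodOrientation G D) {u : V}
    (hu : (G.neighborSet u).ncard = 1) : ∃ D', IsGoodOrientation (addTrueTwin G u) D' := by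
  obtain ⟨w, hw⟩ := Set.ncard_eq_one.1 hu
  have hadj : ∀ x, G.Adj u x ↔ x = w := fun x => by
    rw [← G.mem_neighborSet, hw]; rfl
  have hi : HasIndepNbhd G u := by
    intro x hx y hy
    rw [hw] at hx hy
    obtain rfl : x = w := hx
    obtain rfl : y = x := hy
    exact G.irrefl
  wlog hsrc : ∀ y, ¬ D.Adj y u generalizing D
  · exact this h.reverse ((h.source_or_sink u hi).resolve_left hsrc)
  have hne : u ≠ w := ((hadj w).2 rfl).ne
  refine ⟨addVertexDigraph D {w} {u}, ?_, ?_, ?_, ?_, ?_⟩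
  · intro x y h'
    rcases x with _ | x <;> rcases y with _ | y
    · exact h'.elim
    · exact Or.inl h'
    · exact Or.inr ((hadj x).2 h')
    · exact h.adj h'
  · intro x y h'
    rcases x with _ | x <;> rcases y with _ | y
    · exact h'.elim
    · exact h'.imp id (hadj y).1
    · exact (h'.imp id (hadj x).1).symm
    · exact h.adj_or h'
  · intro x y h1 h2
    rcases x with _ | x <;> rcases y with _ | y
    · exact h1
    · exact hne (Eq.trans (Eq.symm h1) h2)
    · exact hne (Eq.trans (Eq.symm h2) h1)
    · exact h.asymm h1 h2
  · exact h.sc.addTriangle hsrc fun y hy => (hadj y).1 (h.adj hy)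
  · have huw : G.Adj u w := (hadj w).2 rfl
    intro x hx
    rcases x with _ | x
    · exact absurd huw (hx (some u) (Or.inl rfl) (some w) (Or.inr huw))
    · have hxw : x ≠ w := by
        rintro rfl
        exact hx none (Or.inr huw) (some u) huw.symm (Or.inl rfl)
      have hxu : x ≠ u := by
        rintro rfl
        exact hx none (Or.inl rfl) (some w) huw (Or.inr huw)
      rcases h.source_or_sink x hx.of_addVertex with h1 | h1
      · left
        rintro (_ | y) h'
        · exact hxu h'
        · exact h1 y h'
      · right
        rintro (_ | y) h'
        · exact hxw h'
        · exact h1 y h'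

lemma IsGoodOrientation.exists_iso {W : Type u} {H : SimpleGraph W} (h : IsGoodOrientation G D)
    (e : G ≃g H) : ∃ D', IsGoodOrientation H D' := by
  refine ⟨⟨fun x y => D.Adj (e.symm x) (e.symm y)⟩, ?_, ?_, ?_, ?_, ?_⟩
  · exact fun h' => e.symm.map_adj_iff.1 (h.adj h')
  · exact fun h' => h.adj_or (e.symm.map_adj_iff.2 h')
  · exact fun h' => h.asymm h'
  · have key : ∀ s t p, IsDiPath ⟨fun x y => D.Adj (e.symm x) (e.symm y)⟩ s t p →
        IsDiPath D (e.symm s) (e.symm t) (p.map e.symm) := by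
      rintro s t p ⟨h1, h2, h3, h4⟩
      refine ⟨(List.isChain_map _).2 h1, h2.map e.symm.injective, ?_, ?_⟩
      · rw [List.head?_map, h3]; rfl
      · rw [List.getLast?_map, h4]; rfl
    exact fun s t p q hp hq =>
      List.map_injective_iff.2 e.symm.injective (h.sc _ _ _ _ (key s t p hp) (key s t q hq))
  · intro u hu
    have : HasIndepNbhd G (e.symm u) := by
      intro x hx y hy hxy
      refine hu (e x) ?_ (e y) ?_ (e.map_adj_iff.2 hxy)
      · simpa using e.map_adj_iff.2 hx
      · simpa using e.map_adj_iff.2 hy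
    exact (h.source_or_sink _ this).imp (fun h' y => h' _) (fun h' y => h' _)

lemma IsStronglyDistanceHereditary.exists_isGoodOrientation
    (hG : IsStronglyDistanceHereditary G) : ∃ D, IsGoodOrientation G D := by
  induction hG with
  | single =>
    refine ⟨⟨fun _ _ => False⟩, fun h => h.elim, fun h => h.elim, fun h => h.elim, ?_,
      fun u _ => Or.inl fun y h => h⟩
    have key : ∀ s t p, IsDiPath ⟨fun _ _ : PUnit => False⟩ s t p → p = [s] := by
      rintro s t p ⟨h1, -, h3, -⟩
      match p, h1, h3 with
      | [a], _, _ => rfl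
      | a :: b :: l, h1, _ => exact (List.isChain_cons_cons.1 h1).1.elim
    exact fun s t p q hp hq => (key s t p hp).trans (key s t q hq).symm
  | pendant u _ ih => obtain ⟨D, h⟩ := ih; exact h.exists_addPendant u
  | trueTwin u hu _ ih => obtain ⟨D, h⟩ := ih; exact h.exists_addTrueTwin hu
  | falseTwin u hu _ ih => obtain ⟨D, h⟩ := ih; exact h.exists_addFalseTwin hu
  | iso e _ ih => obtain ⟨D, h⟩ := ih; exact h.exists_iso e

lemma IsStronglyDistanceHereditary.isSCOrientable (hG : IsStronglyDistanceHereditary G) :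
    IsSCOrientable G :=
  let ⟨_, h⟩ := hG.exists_isGoodOrientation
  h.isSCOrientable

end

/-! ### Induced cycles through a vertex -/

section

variable {V : Type u} {G : SimpleGraph V}

/-- Geodesics are induced paths: the `i`-th vertex is at distance `i` from `a`, and distances of
adjacent vertices differ by at most one. -/
lemma getVert_adj_of_dist {a b : V} {q : G.Walk a b} (hq : q.length = G.dist a b) {i j : ℕ}
    (hi : i ≤ q.length) (hj : j ≤ q.length) :
    (q.getVert i = q.getVert j → i = j) ∧
      (G.Adj (q.getVert i) (q.getVert j) ↔ i + 1 = j ∨ j + 1 = i) := by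
  have dist_eq : ∀ k ≤ q.length, G.dist a (q.getVert k) = k := by
    intro k hk
    rw [← length_eq_dist_of_subwalk hq (q.isSubwalk_take k), Walk.take_length]
    exact min_eq_left hk
  refine ⟨fun h => ?_, fun h => ?_, ?_⟩
  · rw [← dist_eq i hi, ← dist_eq j hj, h]
  · have hne : i ≠ j := by rintro rfl; exact h.ne rfl
    have h1 := h.diff_dist_adj (u := a)
    rw [dist_eq i hi, dist_eq j hj] at h1
    omega
  · rintro (rfl | rfl)
    · exact q.adj_getVert_succ (by omega)
    · exact (q.adj_getVert_succ (by omega)).symm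

/-- If `x` sees exactly the end vertices of a geodesic of length `m`, then `x` and the geodesic form
an induced cycle of length `m + 2`. -/
lemma cycleGraph_isIndContained_of_geodesic {x a b : V} {S : Set V} (ha : a ∈ S) (hb : b ∈ S)
    (hxa : G.Adj x a) (hxb : G.Adj x b) (hS : ∀ v ∈ S, v = a ∨ v = b ∨ ¬ G.Adj x v) (hxS : x ∉ S)
    (q : (G.induce S).Walk ⟨a, ha⟩ ⟨b, hb⟩)
    (hq : q.length = (G.induce S).dist ⟨a, ha⟩ ⟨b, hb⟩) :
    (cycleGraph (q.length + 2)).IsIndContained G := by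
  have hadj : ∀ i ≤ q.length, (G.Adj x (q.getVert i) ↔ i = 0 ∨ i = q.length) := by
    intro i hi
    constructor
    · intro h
      rcases hS _ (q.getVert i).2 with h' | h' | h'
      · left
        refine (getVert_adj_of_dist hq hi (Nat.zero_le _)).1 ?_
        rw [Walk.getVert_zero]; exact Subtype.ext h'
      · right
        refine (getVert_adj_of_dist hq hi le_rfl).1 ?_
        rw [Walk.getVert_length]; exact Subtype.ext h'
      · exact absurd h h'
    · rintro (rfl | rfl)
      · rw [Walk.getVert_zero]; exact hxa
      · rw [Walk.getVert_length]; exact hxb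
  -- The last index, `q.length + 1`, carries `x`.
  let f : Fin (q.length + 2) → V := fun i => if i.val ≤ q.length then q.getVert i else x
  have hf : ∀ i : Fin (q.length + 2), (i.val ≤ q.length ∧ f i = q.getVert i) ∨
      (i.val = q.length + 1 ∧ f i = x) := by
    intro i
    by_cases h : i.val ≤ q.length
    · exact Or.inl ⟨h, if_pos h⟩
    · exact Or.inr ⟨by omega, if_neg h⟩
  refine ⟨⟨⟨f, ?_⟩, ?_⟩⟩
  · intro i j hij
    rcases hf i with ⟨hi, ei⟩ | ⟨hi, ei⟩ <;> rcases hf j with ⟨hj, ej⟩ | ⟨hj, ej⟩ <;>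
      rw [ei, ej] at hij
    · exact Fin.ext ((getVert_adj_of_dist hq hi hj).1 (Subtype.ext hij))
    · exact absurd (hij ▸ (q.getVert i).2) hxS
    · exact absurd (hij ▸ (q.getVert j).2) hxS
    · exact Fin.ext (hi.trans hj.symm)
  · intro i j
    change G.Adj (f i) (f j) ↔ _
    rw [cycleGraph_adj_iff_val (by omega)]
    rcases hf i with ⟨hi, ei⟩ | ⟨hi, ei⟩ <;> rcases hf j with ⟨hj, ej⟩ | ⟨hj, ej⟩ <;>
      rw [ei, ej]
    · have := (getVert_adj_of_dist hq hi hj).2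
      rw [induce_adj] at this
      rw [this]
      omega
    · rw [G.adj_comm, hadj _ hi]
      omega
    · rw [hadj _ hj]
      omega
    · simp only [SimpleGraph.irrefl, false_iff]
      omega

/-- In a graph without holes, two nonadjacent neighbours of `x` that are joined by a walk through
non-neighbours of `x` have a common neighbour on that walk. -/
lemma exists_common_adj_of_walk
    (hG : ∀ n : ℕ, 5 ≤ n → ¬ (cycleGraph n).IsIndContained G) {x a b : V}
    (hxa : G.Adj x a) (hxb : G.Adj x b) (hab : ¬ G.Adj a b) (hne : a ≠ b) {S : Set V}
    (p : G.Walk a b) (hp : ∀ v ∈ p.support, v = a ∨ v = b ∨ v ∈ S)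
    (hS : ∀ v ∈ S, v ≠ x ∧ ¬ G.Adj x v) :
    ∃ v ∈ S, G.Adj a v ∧ G.Adj b v := by
  let T : Set V := {v | v = a ∨ v = b ∨ v ∈ S}
  have ha : a ∈ T := Or.inl rfl
  have hb : b ∈ T := Or.inr (Or.inl rfl)
  -- A geodesic inside `T` closes up with `x` to an induced cycle. Without holes its length is at
  -- most two, and it is at least two since `a` and `b` are distinct and nonadjacent.
  obtain ⟨q, hq⟩ := (p.induce T hp).reachable.exists_walk_length_eq_dist
  have hcyc := cycleGraph_isIndContained_of_geodesic (S := T) ha hb hxa hxb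
    (fun v hv => hv.imp id (Or.imp id fun h => (hS v h).2))
    (by
      rintro (h | h | h)
      · exact hxa.ne h
      · exact hxb.ne h
      · exact (hS x h).1 rfl) q hq
  have hlen : q.length < 3 := by
    by_contra h
    exact hG _ (by omega) hcyc
  have h0 : q.getVert 0 = ⟨a, ha⟩ := q.getVert_zero
  have hl : q.getVert q.length = ⟨b, hb⟩ := q.getVert_length
  have hlen0 : q.length ≠ 0 := by
    intro h
    rw [h, h0] at hl
    exact hne (congrArg Subtype.val hl)
  have hlen1 : q.length ≠ 1 := by
    intro h
    have := q.adj_getVert_succ (i := 0) (by omega)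
    rw [h] at hl
    rw [h0, zero_add, hl] at this
    exact hab this
  have hlen2 : q.length = 2 := by omega
  have h1 := q.adj_getVert_succ (i := 0) (by omega)
  have h2 := q.adj_getVert_succ (i := 1) (by omega)
  rw [hlen2] at hl
  rw [h0, zero_add] at h1
  rw [show 1 + 1 = 2 from rfl, hl] at h2
  refine ⟨q.getVert 1, ?_, h1, h2.symm⟩
  rcases (q.getVert 1).2 with h | h | h
  · exact absurd (Subtype.ext h.symm) h1.ne
  · exact absurd (Subtype.ext h) h2.ne
  · exact h

end

/-! ### Distance levels -/

section

variable {V : Type u} {G : SimpleGraph V} {r : V}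

/-- The vertices at distance `j` from `r`. -/
def level (G : SimpleGraph V) (r : V) (j : ℕ) : Set V := {v | G.edist r v = j}

lemma level_unique {i j : ℕ} {v : V} (hi : v ∈ level G r i) (hj : v ∈ level G r j) : i = j := by
  have : (i : ℕ∞) = j := hi.symm.trans hj
  exact_mod_cast this

lemma mem_level_zero {v : V} : v ∈ level G r 0 ↔ v = r := by
  simp [level, eq_comm (a := v)]

lemma exists_mem_level_of_adj {j : ℕ} {v w : V} (hv : v ∈ level G r j) (h : G.Adj v w) :
    ∃ i, w ∈ level G r i ∧ i ≤ j + 1 ∧ j ≤ i + 1 := by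
  have h1 : G.edist v w = 1 := edist_eq_one_iff_adj.2 h
  have h2 : G.edist r w ≤ G.edist r v + G.edist v w := G.edist_triangle
  have h3 : G.edist r v ≤ G.edist r w + G.edist w v := G.edist_triangle
  rw [edist_comm (u := w), h1] at h3
  rw [h1] at h2
  rw [show G.edist r v = j from hv] at h2 h3
  have hne : G.edist r w ≠ ⊤ := fun h => by
    rw [h] at h2
    exact absurd (top_le_iff.1 h2) (by exact_mod_cast ENat.natCast_ne_top (j + 1))
  obtain ⟨i, hi⟩ := ENat.ne_top_iff_exists.1 hne
  rw [← hi] at h2 h3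
  exact ⟨i, hi.symm, by exact_mod_cast h2, by exact_mod_cast h3⟩

lemma level_le_of_adj {i j : ℕ} {v w : V} (hv : v ∈ level G r i) (hw : w ∈ level G r j)
    (h : G.Adj v w) : i ≤ j + 1 := by
  obtain ⟨j', hj', -, h'⟩ := exists_mem_level_of_adj hv h
  rwa [level_unique hw hj']

lemma exists_adj_level {j : ℕ} {v : V} (hv : v ∈ level G r (j + 1)) :
    ∃ w ∈ level G r j, G.Adj v w := by
  obtain ⟨p, hp⟩ := exists_walk_of_edist_eq_coe (show G.edist r v = ((j + 1 : ℕ) : ℕ∞) from hv)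
  cases hq : p.reverse with
  | nil =>
    have := congrArg Walk.length hq
    simp [hp] at this
  | @cons _ w _ h q =>
    refine ⟨w, ?_, h⟩
    have hl := congrArg Walk.length hq
    simp only [Walk.length_reverse, hp, Walk.length_cons] at hl
    obtain ⟨i, hi, -, h2⟩ := exists_mem_level_of_adj hv h
    have h3 : G.edist r w ≤ q.reverse.length := edist_le _
    rw [show G.edist r w = i from hi, Walk.length_reverse] at h3
    have h4 : i ≤ q.length := by exact_mod_cast h3
    obtain rfl : i = j := by omega
    exact hi

lemma exists_walk_to_root {j : ℕ} {v : V} (hv : v ∈ level G r j) :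
    ∃ p : G.Walk v r, ∀ w ∈ p.support, w = v ∨ ∃ i < j, w ∈ level G r i := by
  induction j generalizing v with
  | zero =>
    obtain rfl := mem_level_zero.1 hv
    exact ⟨.nil, by simp⟩
  | succ j ih =>
    obtain ⟨w, hw, hvw⟩ := exists_adj_level hv
    obtain ⟨p, hp⟩ := ih hw
    refine ⟨.cons hvw p, ?_⟩
    intro z hz
    rw [Walk.support_cons, List.mem_cons] at hz
    rcases hz with rfl | hz
    · exact Or.inl rfl
    · right
      rcases hp z hz with rfl | ⟨i, hi, hz⟩
      · exact ⟨j, by omega, hw⟩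
      · exact ⟨i, by omega, hz⟩

/-- Any two vertices are joined by a walk through lower levels. -/
lemma exists_walk_through_lower {i j : ℕ} {v w : V} (hv : v ∈ level G r i)
    (hw : w ∈ level G r j) :
    ∃ p : G.Walk v w, ∀ z ∈ p.support, z = v ∨ z = w ∨ (∃ k < max i j, z ∈ level G r k) := by
  obtain ⟨p, hp⟩ := exists_walk_to_root hv
  obtain ⟨q, hq⟩ := exists_walk_to_root hw
  refine ⟨p.append q.reverse, fun z hz => ?_⟩
  rw [Walk.mem_support_append_iff, Walk.support_reverse, List.mem_reverse] at hz
  rcases hz with hz | hz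
  · rcases hp z hz with h | ⟨k, hk, h⟩
    · exact Or.inl h
    · exact Or.inr (Or.inr ⟨k, lt_max_of_lt_left hk, h⟩)
  · rcases hq z hz with h | ⟨k, hk, h⟩
    · exact Or.inr (Or.inl h)
    · exact Or.inr (Or.inr ⟨k, lt_max_of_lt_right hk, h⟩)

lemma not_adj_of_level {i j : ℕ} {v w : V} (hv : v ∈ level G r i) (hw : w ∈ level G r j)
    (hij : i + 1 < j) : ¬ G.Adj w v := fun h => by
  have := level_le_of_adj hw hv h
  omega

lemma ne_of_level {i j : ℕ} {v w : V} (hv : v ∈ level G r i) (hw : w ∈ level G r j)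
    (hij : i ≠ j) : w ≠ v := by
  rintro rfl
  exact hij (level_unique hv hw)

end

/-! ### The level structure of graphs without holes, houses, dominoes and diamonds -/

section

variable {V : Type u} {G : SimpleGraph V} {r : V}

/-- The form in which diamond-freeness is used: an edge lies on at most one triangle. -/
lemma IsHHDDFree.eq_of_adj (hG : IsHHDDFree G) {a b c d : V} (hab : G.Adj a b) (hbc : G.Adj b c)
    (hcd : G.Adj c d) (hda : G.Adj d a) (hac : G.Adj a c) : b = d := by
  by_contra h
  exact hG.diamond_free (diamond_isContained_iff.2 ⟨a, b, c, d, hab, hbc, hcd, hda, hac, h⟩)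

/-- Two vertices of a level that are adjacent, or have a common neighbour in the next level, have
the same neighbours in the previous level. -/
lemma IsHHDDFree.lower_adj (hG : IsHHDDFree G) {j : ℕ} {a b c : V} (ha : a ∈ level G r (j + 1))
    (hb : b ∈ level G r (j + 1))
    (h : G.Adj a b ∨ ∃ x ∈ level G r (j + 2), G.Adj x a ∧ G.Adj x b)
    (hc : c ∈ level G r j) (hac : G.Adj a c) : G.Adj b c := by
  induction j generalizing a b c with
  | zero =>
    obtain ⟨d, hd, hbd⟩ := exists_adj_level hb
    rwa [mem_level_zero.1 hc, ← mem_level_zero.1 hd]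
  | succ j ih =>
    by_contra hbc
    -- a common lower neighbour of two distinct vertices below
    have low : ∀ {d}, d ∈ level G r (j + 1) →
        (G.Adj c d ∨ ∃ y ∈ level G r (j + 2), G.Adj y c ∧ G.Adj y d) →
        ∃ e ∈ level G r j, G.Adj c e ∧ G.Adj d e := by
      intro d hd h'
      obtain ⟨e, he, hce⟩ := exists_adj_level hc
      exact ⟨e, he, hce, ih hc hd h' he hce⟩
    have hnab : a ≠ b := by rintro rfl; exact hbc hac
    have hnbc : b ≠ c := ne_of_level hc hb (by omega)
    by_cases hab : G.Adj a b
    -- A common lower neighbour `d` gives a house: the 4-cycle `c e d a` with roof `b`.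
    · by_cases hd : ∃ d ∈ level G r (j + 1), G.Adj a d ∧ G.Adj b d
      · obtain ⟨d, hd, had, hbd⟩ := hd
        obtain ⟨e, he, hce, hde⟩ := low hd (Or.inr ⟨a, ha, hac, had⟩)
        have hcd : ¬ G.Adj c d := fun hcd =>
          hnbc (hG.eq_of_adj hac hcd hbd.symm hab.symm had).symm
        exact hG.house_free (house_isIndContained hce hde.symm had.symm hac hbd.symm hab hcd
          (fun h => not_adj_of_level he ha (by omega) h.symm) (fun h => hbc h.symm)
          (fun h => not_adj_of_level he hb (by omega) h.symm))
      · obtain ⟨d, hd', hbd⟩ := exists_adj_level hb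
        have had : ¬ G.Adj a d := fun had => hd ⟨d, hd', had, hbd⟩
        -- If `c` and `d` are adjacent, the 4-cycle `a b d c` with roof `e` is a house. Otherwise
        -- `a` sees only the ends of a walk from `c` through lower levels and `d` to `b`, whose ends
        -- have no common neighbour on it.
        by_cases hcd : G.Adj c d
        · obtain ⟨e, he, hce, hde⟩ := low hd' (Or.inl hcd)
          exact hG.house_free (house_isIndContained hab hbd hcd.symm hac.symm hde hce had hbc
            (not_adj_of_level he ha (by omega)) (not_adj_of_level he hb (by omega)))
        · obtain ⟨p, hp⟩ := exists_walk_through_lower hc hd'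
          obtain ⟨v, hv, hcv, hbv⟩ := exists_common_adj_of_walk hG.hole_free (x := a) (a := c)
            (b := b) (S := {v | v = d ∨ ∃ k < j + 1, v ∈ level G r k}) hac hab
            (fun h => hbc h.symm) hnbc.symm (p.append (.cons hbd.symm .nil))
            (by
              intro v hv
              simp only [Walk.mem_support_append_iff, Walk.support_cons, Walk.support_nil,
                List.mem_cons, List.not_mem_nil, or_false] at hv
              rcases hv with hv | rfl | rfl
              · rcases hp v hv with h | h | ⟨k, hk, h⟩
                · exact Or.inl h
                · exact Or.inr (Or.inr (Or.inl h))
                · exact Or.inr (Or.inr (Or.inr ⟨k, by omega, h⟩))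
              · exact Or.inr (Or.inr (Or.inl rfl))
              · exact Or.inr (Or.inl rfl))
            (by
              rintro v (rfl | ⟨k, hk, hv⟩)
              · exact ⟨(ne_of_level hd' ha (by omega)).symm, had⟩
              · exact ⟨(ne_of_level hv ha (by omega)).symm, not_adj_of_level hv ha (by omega)⟩)
          rcases hv with rfl | ⟨k, hk, hv⟩
          · exact hcd hcv
          · exact not_adj_of_level hv hb (by omega) hbv
    · obtain ⟨x, hx, hxa, hxb⟩ := h.resolve_left hab
      -- `x` sees only the ends of this walk, so `a` and `b` share a lower neighbour `d`. With `e`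
      -- below `c` and `d`, the rungs `xb`, `ad`, `ce` form a domino.
      obtain ⟨p, hp⟩ := exists_walk_through_lower ha hb
      obtain ⟨d, ⟨k, hk, hd⟩, had, hbd⟩ := exists_common_adj_of_walk hG.hole_free
        (S := {v | ∃ k < j + 2, v ∈ level G r k}) hxa hxb hab hnab p
        (fun v hv => (hp v hv).imp id (Or.imp id fun ⟨k, hk, h⟩ => ⟨k, by omega, h⟩))
        (fun v ⟨k, hk, hv⟩ =>
          ⟨(ne_of_level hv hx (by omega)).symm, not_adj_of_level hv hx (by omega)⟩)
      obtain rfl : k = j + 1 := by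
        have := level_le_of_adj ha hd had
        omega
      obtain ⟨e, he, hce, hde⟩ := low hd (Or.inr ⟨a, ha, hac, had⟩)
      have hcd : ¬ G.Adj c d := fun hcd =>
        ne_of_level he ha (by omega) (hG.eq_of_adj hac.symm had hde hce.symm hcd)
      exact hG.domino_free (domino_isIndContained hxb had hce hxa hac hbd hde
        (not_adj_of_level hd hx (by omega)) (not_adj_of_level hc hx (by omega))
        (not_adj_of_level he hx (by omega)) (fun h => hab h.symm) hbc
        (not_adj_of_level he hb (by omega)) (not_adj_of_level he ha (by omega))
        (fun h => hcd h.symm) (ne_of_level he hx (by omega)) hnbc)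

/-- Adjacent vertices of the last level have exactly one further neighbour. -/
lemma IsHHDDFree.adj_of_adj_last_level (hG : IsHHDDFree G) {m : ℕ}
    (hlast : ∀ i v, v ∈ level G r i → i ≤ m + 1) {x y a z : V} (hx : x ∈ level G r (m + 1))
    (hy : y ∈ level G r (m + 1)) (ha : a ∈ level G r m) (hxy : G.Adj x y) (hxa : G.Adj x a)
    (hxz : G.Adj x z) : z = y ∨ z = a := by
  have hya : G.Adj y a := hG.lower_adj hx hy (Or.inl hxy) ha hxa
  obtain ⟨i, hz, -, hi⟩ := exists_mem_level_of_adj hx hxz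
  have hi' := hlast i z hz
  -- On either level, `lower_adj` puts `z` on a triangle sharing an edge with the triangle `x y a`.
  obtain rfl | rfl : i = m + 1 ∨ i = m := by omega
  · left
    have hza : G.Adj z a := hG.lower_adj hx hz (Or.inl hxz) ha hxa
    exact (hG.eq_of_adj hxy hya hza.symm hxz.symm hxa).symm
  · right
    have hyz : G.Adj y z := hG.lower_adj hx hy (Or.inl hxy) hz hxz
    exact (hG.eq_of_adj hxa hya.symm hyz hxz.symm hxy).symm

/-- If the last level is independent, then two neighbours of a vertex of minimum degree in the last
level are false twins. -/
lemma IsHHDDFree.adj_of_minimal [Finite V] (hG : IsHHDDFree G) {n : ℕ}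
    (hlast : ∀ x ∈ level G r (n + 2), ∀ y, G.Adj x y → y ∈ level G r (n + 1)) {x a b w : V}
    (hx : x ∈ level G r (n + 2))
    (hmin : ∀ y ∈ level G r (n + 2), (G.neighborSet x).ncard ≤ (G.neighborSet y).ncard)
    (hxa : G.Adj x a) (hxb : G.Adj x b) (hab : a ≠ b) (haw : G.Adj a w) : G.Adj b w := by
  have ha := hlast x hx a hxa
  have hb := hlast x hx b hxb
  obtain ⟨e, he, hae⟩ := exists_adj_level ha
  have hbe : G.Adj b e := hG.lower_adj ha hb (Or.inr ⟨x, hx, hxa, hxb⟩) he hae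
  have hxe : x ≠ e := ne_of_level he hx (by omega)
  have hnab : ¬ G.Adj a b := fun h => hxe (hG.eq_of_adj hxa.symm hxb hbe hae.symm h)
  by_contra hbw
  obtain ⟨i, hw, h1, h2⟩ := exists_mem_level_of_adj ha haw
  obtain rfl | rfl | rfl : i = n ∨ i = n + 1 ∨ i = n + 2 := by omega
  · exact hbw (hG.lower_adj ha hb (Or.inr ⟨x, hx, hxa, hxb⟩) hw haw)
  -- House: the 4-cycle `x b e a` with roof `w`.
  · have hwe : G.Adj w e := hG.lower_adj ha hw (Or.inl haw) he hae
    exact hG.house_free (house_isIndContained hxb hbe hae.symm hxa.symm hwe.symm haw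
      (not_adj_of_level he hx (by omega)) (fun h => hnab h.symm)
      (fun h => hxe (hG.eq_of_adj hxa.symm h hwe hae.symm haw)) hbw)
  -- Otherwise `w`, which misses `b`, would have smaller degree than `x`. Then `x a w c b` is a
  -- 5-cycle if `b` and `c` are adjacent; if not, the rungs `xb`, `ae`, `wc` form a domino.
  · obtain ⟨c, hwc, hxc⟩ : ∃ c, G.Adj w c ∧ ¬ G.Adj x c := by
      by_contra! h
      have hss : G.neighborSet w ⊂ G.neighborSet x :=
        ⟨fun c hc => h c hc, fun h' => hbw (h' hxb).symm⟩
      exact absurd (hmin w hw) (not_le.2 (Set.ncard_lt_ncard hss))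
    have hc := hlast w hw c hwc
    have hce : G.Adj c e := hG.lower_adj ha hc (Or.inr ⟨w, hw, haw.symm, hwc⟩) he hae
    have hac : ¬ G.Adj a c := fun h =>
      ne_of_level he hw (by omega) (hG.eq_of_adj haw hwc hce hae.symm h)
    have hxw : ¬ G.Adj x w := fun h => by
      have := level_unique hw (hlast x hx w h)
      omega
    by_cases hbc : G.Adj b c
    · obtain ⟨v, rfl | rfl, hav, hbv⟩ := exists_common_adj_of_walk hG.hole_free (S := {w, c}) hxa hxb
        hnab hab (.cons haw (.cons hwc (.cons hbc.symm .nil))) (by simp)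
        (by
          rintro v (rfl | rfl)
          · exact ⟨by rintro rfl; exact hbw hxb.symm, hxw⟩
          · exact ⟨(ne_of_level hc hx (by omega)).symm, hxc⟩)
      · exact hbw hbv
      · exact hac hav
    · exact hG.domino_free (domino_isIndContained hxb hae hwc hxa haw hbe hce.symm
        (not_adj_of_level he hx (by omega)) hxw hxc (fun h => hnab h.symm) hbw hbc hac
        (fun h => not_adj_of_level he hw (by omega) h.symm) (ne_of_level hc hx (by omega))
        (ne_of_level hw hb (by omega)))

/-- A graph without holes, houses, dominoes and diamonds has a pendant vertex, a triangle with two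
vertices of degree two, or false twins. -/
lemma IsHHDDFree.exists_pendant_or_twins [Finite V] [Nontrivial V] (hG : IsHHDDFree G) :
    (∃ v u, ∀ w, G.Adj v w ↔ w = u) ∨
    (∃ v u w, (∀ z, G.Adj v z ↔ z = u ∨ z = w) ∧ ∀ z, G.Adj u z ↔ z = v ∨ z = w) ∨
    (∃ v u, v ≠ u ∧ ∀ w, G.Adj v w ↔ G.Adj u w) := by
  by_cases hedge : ∃ r s, G.Adj r s
  swap
  · push Not at hedge
    obtain ⟨v, u, hvu⟩ := exists_pair_ne V
    exact Or.inr (Or.inr ⟨v, u, hvu, fun w => by simp [hedge]⟩)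
  obtain ⟨r, s, hrs⟩ := hedge
  have hs : s ∈ level G r 1 := edist_eq_one_iff_adj.2 hrs
  obtain ⟨x₀, ⟨k, hk⟩, hmax⟩ := Set.exists_max_image {v | ∃ j, v ∈ level G r j} (G.edist r)
    (Set.toFinite _) ⟨s, 1, hs⟩
  have hlast : ∀ i v, v ∈ level G r i → i ≤ k := by
    intro i v hv
    have := hmax v ⟨i, hv⟩
    rw [show G.edist r v = i from hv, show G.edist r x₀ = k from hk] at this
    exact_mod_cast this
  -- The root has a neighbour, so the last level is not level zero.
  obtain ⟨m, rfl⟩ : ∃ m, k = m + 1 := ⟨k - 1, by have := hlast 1 s hs; omega⟩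
  by_cases hadj : ∃ x ∈ level G r (m + 1), ∃ y ∈ level G r (m + 1), G.Adj x y
  · obtain ⟨x, hx, y, hy, hxy⟩ := hadj
    obtain ⟨a, ha, hxa⟩ := exists_adj_level hx
    have hya : G.Adj y a := hG.lower_adj hx hy (Or.inl hxy) ha hxa
    refine Or.inr (Or.inl ⟨x, y, a, fun z => ⟨?_, ?_⟩, fun z => ⟨?_, ?_⟩⟩)
    · exact hG.adj_of_adj_last_level hlast hx hy ha hxy hxa
    · rintro (rfl | rfl) <;> assumption
    · exact hG.adj_of_adj_last_level hlast hy hx ha hxy.symm hya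
    · rintro (rfl | rfl)
      · exact hxy.symm
      · exact hya
  push Not at hadj
  have hdown : ∀ x ∈ level G r (m + 1), ∀ y, G.Adj x y → y ∈ level G r m := by
    intro x hx y hxy
    obtain ⟨i, hy, -, hi⟩ := exists_mem_level_of_adj hx hxy
    have hi' := hlast i y hy
    obtain rfl | rfl : i = m + 1 ∨ i = m := by omega
    · exact absurd hxy (hadj x hx y hy)
    · exact hy
  obtain ⟨x, hx, hmin⟩ := Set.exists_min_image (level G r (m + 1))
    (fun x => (G.neighborSet x).ncard) (Set.toFinite _) ⟨x₀, hk⟩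
  obtain ⟨a, ha, hxa⟩ := exists_adj_level hx
  by_cases hb : ∃ b, G.Adj x b ∧ b ≠ a
  · obtain ⟨b, hxb, hba⟩ := hb
    cases m with
    | zero =>
      exact absurd ((mem_level_zero.1 (hdown x hx b hxb)).trans (mem_level_zero.1 ha).symm) hba
    | succ n =>
      exact Or.inr (Or.inr ⟨a, b, hba.symm, fun w =>
        ⟨hG.adj_of_minimal hdown hx hmin hxa hxb hba.symm,
          hG.adj_of_minimal hdown hx hmin hxb hxa hba⟩⟩)
  · push Not at hb
    exact Or.inl ⟨x, a, fun w => ⟨hb w, by rintro rfl; exact hxa⟩⟩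

end

/-! ### Construction by pendant vertices and twins -/

section

lemma IsHHDDFree.of_embedding {V W : Type*} {G : SimpleGraph V} {H : SimpleGraph W}
    (hG : IsHHDDFree G) (f : H ↪g G) : IsHHDDFree H where
  house_free h := hG.house_free (h.trans ⟨f⟩)
  hole_free n hn h := hG.hole_free n hn (h.trans ⟨f⟩)
  domino_free h := hG.domino_free (h.trans ⟨f⟩)
  diamond_free h := hG.diamond_free (h.trans f.isContained)

lemma isStronglyDistanceHereditary_of_subsingleton {V : Type u} [Nonempty V] [Subsingleton V]
    (G : SimpleGraph V) : IsStronglyDistanceHereditary G := by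
  have v := Classical.arbitrary V
  refine .iso ⟨⟨fun _ => v, fun _ => PUnit.unit, fun _ => rfl,
    fun _ => Subsingleton.elim _ _⟩, ?_⟩ .single
  intro a b
  simp

/-- Induction on the number of vertices: the forbidden subgraphs stay absent when the vertex found
by `exists_pendant_or_twins` is deleted, and an admissible operation restores it. -/
theorem IsHHDDFree.isStronglyDistanceHereditary {V : Type u} [Finite V] [Nonempty V]
    {G : SimpleGraph V} (hG : IsHHDDFree G) : IsStronglyDistanceHereditary G := by
  induction hn : Nat.card V generalizing V with
  | zero => exact absurd hn Nat.card_pos.ne'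
  | succ n ih =>
    rcases subsingleton_or_nontrivial V with _ | _
    · exact isStronglyDistanceHereditary_of_subsingleton G
    have step : ∀ v : V,
        IsStronglyDistanceHereditary (G.comap (Subtype.val : {w // w ≠ v} → V)) := by
      intro v
      obtain ⟨w, hw⟩ := exists_ne v
      have : Nonempty {w // w ≠ v} := ⟨⟨w, hw⟩⟩
      refine ih (hG.of_embedding (SimpleGraph.Embedding.comap (.subtype _) G)) ?_
      classical
      have := Finite.card_option (α := {w // w ≠ v})
      rw [Nat.card_congr (Equiv.optionSubtypeNe v), hn] at this
      omega
    rcases hG.exists_pendant_or_twins with ⟨v, u, h⟩ | ⟨v, u, w, hv, hu⟩ | ⟨v, u, hvu, h⟩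
    · have hvu : G.Adj v u := (h u).2 rfl
      exact .iso (addVertexIso G v {⟨u, hvu.ne'⟩} fun w => by
        rw [h, Set.mem_singleton_iff, Subtype.ext_iff]) (.pendant _ (step v))
    · have hvu : G.Adj v u := (hv u).2 (Or.inl rfl)
      have hvw : G.Adj v w := (hv w).2 (Or.inr rfl)
      let u' : {w // w ≠ v} := ⟨u, hvu.ne'⟩
      refine .iso (addVertexIso G v (insert u' ((G.comap Subtype.val).neighborSet u'))
        fun z => ?_) (.trueTwin u' ?_ (step v))
      · rw [hv, Set.mem_insert_iff, mem_neighborSet, comap_adj, hu, Subtype.ext_iff]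
        simp [z.2, u']
      -- Once `v` is deleted, `w` is the only neighbour of `u`, so the true twin is admissible.
      · rw [Set.ncard_eq_one]
        refine ⟨⟨w, hvw.ne'⟩, ?_⟩
        ext z
        rw [mem_neighborSet, comap_adj, hu, Set.mem_singleton_iff, Subtype.ext_iff]
        simp [z.2]
    · refine .iso (addVertexIso G v ((G.comap Subtype.val).neighborSet ⟨u, hvu.symm⟩)
        fun z => ?_) (.falseTwin _ ?_ (step v))
      · rw [h, mem_neighborSet, comap_adj]
      -- An edge in the common neighbourhood of the twins would complete a diamond, so the false
      -- twin is admissible.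
      · intro x hx y hy hxy
        have hux : G.Adj u x := hx
        have huy : G.Adj u y := hy
        exact hvu (hG.eq_of_adj ((h x).2 hux).symm ((h y).2 huy) huy.symm hux hxy)

end

end SCOrient

theorem mainTheorem7 {V : Type u} [Finite V] [Nonempty V] (G : SimpleGraph V) :
    (SCOrient.IsStronglyDistanceHereditary G ↔ SCOrient.IsHHDDFree G) ∧
    (SCOrient.IsStronglyDistanceHereditary G ↔
      SCOrient.IsDistanceHereditary G ∧ SCOrient.IsSCOrientable G) :=
  ⟨⟨fun h => h.isDistanceHereditary.isHHDDFree_of_isSCOrientable h.isSCOrientable,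
    fun h => h.isStronglyDistanceHereditary⟩,
    fun h => ⟨h.isDistanceHereditary, h.isSCOrientable⟩,
    fun h => (h.1.isHHDDFree_of_isSCOrientable h.2).isStronglyDistanceHereditary⟩
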